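/- Let $a,b,c>0$ be real with $b/c\notin\mathbb{Q}$. Let $\tilde\Gamma$ be the metric graph with two vertices $v_1,v_2$, two edges of lengths $2b$ and $2c$, each joining $v_1$ to $v_2$, and two infinite leads, lead $j$ (coordinate $x_j\in[0,\infty)$) starting at $v_j$. Let $\Gamma$ be the compact graph obtained by cutting both leads at length $a$. At $v_1$ and $v_2$ functions are continuous and the sum of the derivatives away from the vertex vanishes; in addition, on $\Gamma$ a Dirichlet condition $f=0$ is imposed at the end of lead 1 and a Neumann condition $f'=0$ at the end of lead 2. A generalized eigenfunction of $\tilde\Gamma$ at $k\in\mathbb{R}\setminus\{0\}$ is a nonzero complex-valued function $f$ on $\tilde\Gamma$ with $-f''=k^2f$ on every edge and lead that satisfies the vertex conditions; $f_j$ is its restriction to lead $j$. Let $\sigma(\Gamma)$ be the set of eigenvalues of $-d^2/dx^2$ on $\Gamma$. The reflection of $\tilde\Gamma$ exchanges $v_1$ and $v_2$ and the two leads, and maps each of the two edges to itself, reversed. Call a generalized eigenfunction $f$ at $k$ a real contra-phasal solution if (1) $f_1$ and $f_2$ are real-valued, and (2) if neither $f_1$ nor $f_2$ vanishes identically, then $$\{x\ge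 0: f_1(x)=0\}=\{x\ge 0: f_2'(x)=0\},\qquad \{x\ge 0: f_2(x)=0\}=\{x\ge 0: f_1'(x)=0\}.$$ Then: 1. For each real $k\neq 0$ a real contra-phasal solution $f(k;\cdot)$ exists, and it is unique up to multiplication by a nonzero real scalar and the reflection: given one solution $f$, the solutions at $k$ are exactly the nonzero real multiples of $f$ and of the reflection of $f$. 2. One can choose a real contra-phasal solution $f(k;\cdot)$ for every $k\neq0$ so that $f(k;x)$ is continuous in $k\in\mathbb{R}\setminus\{0\}$ (jointly in $k$ and the point $x$ on each closed edge and lead). 3. If $k^2\in\sigma(\Gamma)$, then for every real contra-phasal solution $f$ at $k$, the restriction to $\Gamma$ of $f$ or of its reflection is an eigenfunction of $\Gamma$ with eigenvalue $k^2$, and every eigenfunction of $\Gamma$ with this eigenvalue is a nonzero complex multiple of it. -/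

import Mathlib

namespace TwoLeadCycle

open Set

/-- A complex-valued function on the cycle with two leads, given edge by edge.
The cycle has two vertices, numbered `0` and `1`.  Cycle edge `i` joins vertex `0` (coordinate
`x = 0`) to vertex `1` (coordinate `x = ℓ i`); lead `j` starts at vertex `j` (coordinate `x = 0`).
Only the values at coordinates lying in the respective edge are ever used. -/
structure GraphFun where
  edge : Fin 2 → ℝ → ℂ
  lead : Fin 2 → ℝ → ℂ

/-- The lengths `2b` and `2c` of the two edges of the cycle. -/
def edgeLength (b c : ℝ) : Fin 2 → ℝ := ![2 * b, 2 * c]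

/-- The multiple `z • f`. -/
def GraphFun.scale (z : ℂ) (f : GraphFun) : GraphFun where
  edge i x := z * f.edge i x
  lead j x := z * f.lead j x

/-- The function identically zero. -/
def GraphFun.zero : GraphFun where
  edge _ _ := 0
  lead _ _ := 0

/-- The reflection that exchanges the two vertices and the two leads and maps each edge
of the cycle to itself, reversed. -/
def GraphFun.reflect (b c : ℝ) (f : GraphFun) : GraphFun where
  edge i x := f.edge i (edgeLength b c i - x)
  lead j x := f.lead j.rev x

/-- `f` and `g` are equal at all points of the graph whose leads are parametrized by `S`
(`S = [0, ∞)` for the graph with infinite leads, `S = [0, a]` for the compact graph). -/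
def Agree (b c : ℝ) (S : Set ℝ) (f g : GraphFun) : Prop :=
  (∀ i, EqOn (f.edge i) (g.edge i) (Icc 0 (edgeLength b c i))) ∧
    ∀ j, EqOn (f.lead j) (g.lead j) S

/-- `u` is twice differentiable on the interval `s` and `-u'' = lam * u` there
(one-sided derivatives at the end points). -/
def SolvesOn (lam : ℝ) (s : Set ℝ) (u : ℝ → ℂ) : Prop :=
  DifferentiableOn ℝ u s ∧
    ∀ x ∈ s, HasDerivWithinAt (derivWithin u s) (-((lam : ℂ) * u x)) s x

/-- `-f'' = lam * f` on all edges, and at both vertices of the cycle `f` is continuous and the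
derivatives, taken away from the vertex, sum to zero (Neumann-Kirchhoff conditions).
The leads are parametrized by `S`. -/
structure SolvesGraph (b c : ℝ) (S : Set ℝ) (lam : ℝ) (f : GraphFun) : Prop where
  edge_eq : ∀ i, SolvesOn lam (Icc 0 (edgeLength b c i)) (f.edge i)
  lead_eq : ∀ j, SolvesOn lam S (f.lead j)
  cont_zero : ∀ i, f.edge i 0 = f.lead 0 0
  cont_one : ∀ i, f.edge i (edgeLength b c i) = f.lead 1 0
  deriv_zero : derivWithin (f.lead 0) S 0 +
    ∑ i, derivWithin (f.edge i) (Icc 0 (edgeLength b c i)) 0 = 0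
  deriv_one : derivWithin (f.lead 1) S 0 +
    ∑ i, -derivWithin (f.edge i) (Icc 0 (edgeLength b c i)) (edgeLength b c i) = 0

/-- `f` is a generalized eigenfunction, with eigenvalue `k ^ 2`, of the graph with infinite leads.
(For real `k ≠ 0` it is automatically of the form `c_in * exp (-ikx) + c_out * exp (ikx)` on each
lead, in particular bounded.) -/
structure IsGeneralizedEigenfunction (b c k : ℝ) (f : GraphFun) : Prop where
  solves : SolvesGraph b c (Ici 0) (k ^ 2) f
  ne_zero : ¬ Agree b c (Ici 0) f GraphFun.zero

/-- `f` (restricted to lead coordinates in `[0, a]`) is an eigenfunction, with eigenvalue `lam`,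
of the compact graph whose leads are cut at length `a`, with a Dirichlet condition at the end of
lead `0` and a Neumann condition at the end of lead `1`. -/
structure IsEigenfunction (a b c lam : ℝ) (f : GraphFun) : Prop where
  solves : SolvesGraph b c (Icc 0 a) lam f
  dirichlet : f.lead 0 a = 0
  neumann : derivWithin (f.lead 1) (Icc 0 a) a = 0
  ne_zero : ¬ Agree b c (Icc 0 a) f GraphFun.zero

/-- The spectrum of the compact graph: the set of its eigenvalues. -/
def compactSpectrum (a b c : ℝ) : Set ℝ := {lam | ∃ f, IsEigenfunction a b c lam f}

/-- The zeros of `f` on lead `j`. -/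
def GraphFun.leadZeros (f : GraphFun) (j : Fin 2) : Set ℝ :=
  {x | 0 ≤ x ∧ f.lead j x = 0}

/-- The zeros of the derivative of `f` on lead `j`. -/
def GraphFun.leadDerivZeros (f : GraphFun) (j : Fin 2) : Set ℝ :=
  {x | 0 ≤ x ∧ derivWithin (f.lead j) (Ici 0) x = 0}

/-- Real contra-phasal solutions: generalized eigenfunctions that are real on the leads and such
that the zeros on each lead are the zeros of the derivative on the other one.  The latter is a
condition on the phases of the two waves `f.lead 0`, `f.lead 1`; it imposes nothing
when one of these waves has amplitude zero and hence no phase. -/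
structure IsContraPhasal (b c k : ℝ) (f : GraphFun) : Prop where
  eigen : IsGeneralizedEigenfunction b c k f
  real : ∀ j, ∀ x ∈ Ici (0 : ℝ), (starRingEnd ℂ) (f.lead j x) = f.lead j x
  contra : (∀ j, ∃ x ∈ Ici (0 : ℝ), f.lead j x ≠ 0) →
    f.leadZeros 0 = f.leadDerivZeros 1 ∧ f.leadZeros 1 = f.leadDerivZeros 0

/-- The family `k ↦ F k` of functions on the graph with infinite leads is continuous in
`k ≠ 0` (jointly with the point of the graph). -/
def IsContinuousFamily (b c : ℝ) (F : ℝ → GraphFun) : Prop :=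
  (∀ i, ContinuousOn (fun p : ℝ × ℝ => (F p.1).edge i p.2)
    ({0}ᶜ ×ˢ Icc 0 (edgeLength b c i))) ∧
  ∀ j, ContinuousOn (fun p : ℝ × ℝ => (F p.1).lead j p.2) ({0}ᶜ ×ˢ Ici 0)

end TwoLeadCycle

/-!
On every edge and lead a solution of `-u'' = k² u`, `k ≠ 0`, is a wave `A cos (k x) + B sin (k x)`
(`SolvesOn.exists_wave`). Splitting a solution on the graph into its even and odd part under the
reflection shows that the solutions form a two-parameter family `standing b c k t s`, with `t` the
amplitude of the even part and `s` that of the odd part (`SolvesGraph.exists_standing`). Here the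
irrationality of `b / c` enters: it prevents `cos (k b)`, `cos (k c)` from vanishing together, and
likewise the sines, so no solution is supported on the cycle. In the coordinates of
`cos (k x)`, `sin (k x)` the two leads carry the vectors `t • S + s • T` and `t • S - s • T`, where

  `S = (cos (k b) cos (k c), -sin (k b + k c))`, `T = (sin (k b) sin (k c), sin (k b + k c))`

are nonzero (`evenSq_pos`, `oddSq_pos`). The reflection changes the sign of `s`.

Real values on the leads force `t`, `s` to be real. The zeros of one real wave are the zeros of the
derivative of another exactly if their coefficient vectors are orthogonal, and this also covers the
case of a vanishing lead (`contra_iff_orthogonal`). The inner product of the two lead vectors is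
`t² |S|² - s² |T|²`, so the contra-phasal solutions are those with `(t, s)` a nonzero real multiple
of `(|T|, ± |S|)` (`isContraPhasal_iff`). This gives existence, uniqueness up to real scalars and
the reflection, and a continuous choice, as `|S|` and `|T|` depend continuously on `k`.

For an eigenfunction of the compact graph with complex parameters `t`, `s`, the end conditions read
`t S·e + s T·e = 0` and `t S·e' - s T·e' = 0` with `e = (cos (k a), sin (k a))` and `e'` its
rotation by a right angle. Taking squares and adding gives `t² |S|² = s² |T|²` again
(`balanced_of_end_conditions`), so up to a complex factor the eigenfunction is contra-phasal. Since
`S ≠ 0`, the two equations have at most a one-dimensional space of solutions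
(`mul_eq_mul_of_end_conditions`), which makes the eigenvalue simple. The value `k = 0` is not in the
spectrum (`zero_notMem_compactSpectrum`).
-/

namespace TwoLeadCycle

open Set

/-! ### Waves on an interval -/

/-- The solution `A cos (k x) + B sin (k x)` of `-u'' = k² u`. -/
noncomputable def wave (k : ℝ) (A B : ℂ) (x : ℝ) : ℂ :=
  A * (Real.cos (k * x) : ℂ) + B * (Real.sin (k * x) : ℂ)

@[simp]
lemma wave_zero (k : ℝ) (A B : ℂ) : wave k A B 0 = A := by
  simp [wave]

lemma hasDerivAt_wave (k : ℝ) (A B : ℂ) (x : ℝ) :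
    HasDerivAt (wave k A B) (k * wave k B (-A) x) x := by
  have h : HasDerivAt (fun y : ℝ => k * y) k x := by
    simpa using (hasDerivAt_id x).const_mul k
  have h1 := (h.cos.ofReal_comp.const_mul A).add (h.sin.ofReal_comp.const_mul B)
  refine h1.congr_deriv ?_
  simp only [wave]
  push_cast
  ring

lemma derivWithin_wave {s : Set ℝ} {x : ℝ} (hs : UniqueDiffWithinAt ℝ s x) (k : ℝ) (A B : ℂ) :
    derivWithin (wave k A B) s x = k * wave k B (-A) x :=
  (hasDerivAt_wave k A B x).hasDerivWithinAt.derivWithin hs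

lemma solvesOn_wave {s : Set ℝ} (hs : UniqueDiffOn ℝ s) (k : ℝ) (A B : ℂ) :
    SolvesOn (k ^ 2) s (wave k A B) := by
  refine ⟨fun x _ => (hasDerivAt_wave k A B x).differentiableAt.differentiableWithinAt,
    fun x hx => ?_⟩
  have h := ((hasDerivAt_wave k B (-A) x).const_mul (k : ℂ)).hasDerivWithinAt (s := s)
  refine (h.congr_deriv ?_).congr (fun y hy => derivWithin_wave (hs y hy) k A B)
    (derivWithin_wave (hs x hx) k A B)
  simp only [wave]
  push_cast
  ring

lemma SolvesOn.congr {lam : ℝ} {s : Set ℝ} {u v : ℝ → ℂ} (hv : SolvesOn lam s v)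
    (h : EqOn u v s) : SolvesOn lam s u := by
  refine ⟨hv.1.congr h, fun x hx => ?_⟩
  rw [h hx]
  exact (hv.2 x hx).congr (fun y hy => derivWithin_congr h (h hy)) (derivWithin_congr h (h hx))

lemma eq_of_hasDerivWithinAt_zero {s : Set ℝ} (hconv : Convex ℝ s) {u : ℝ → ℂ}
    (hu : ∀ x ∈ s, HasDerivWithinAt u 0 s x) {x y : ℝ} (hx : x ∈ s) (hy : y ∈ s) :
    u x = u y := by
  have h := hconv.norm_image_sub_le_of_norm_hasDerivWithin_le (f := u) (C := 0) hu (by simp) hy hx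
  simpa [sub_eq_zero] using h

/-- Every solution of `-u'' = k² u` on an interval containing `0` is a wave: the functions
`u cos (k x) - (u' / k) sin (k x)` and `u sin (k x) + (u' / k) cos (k x)` are constant. -/
lemma SolvesOn.exists_wave {k : ℝ} (hk : k ≠ 0) {s : Set ℝ} (hconv : Convex ℝ s)
    (h0 : (0 : ℝ) ∈ s) {u : ℝ → ℂ} (hu : SolvesOn (k ^ 2) s u) :
    ∃ A B : ℂ, EqOn u (wave k A B) s := by
  have hkC : (k : ℂ) ≠ 0 := by exact_mod_cast hk
  have hlin : ∀ x : ℝ, HasDerivAt (fun y : ℝ => k * y) k x := fun x => by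
    simpa using (hasDerivAt_id x).const_mul k
  have hcos : ∀ x : ℝ, HasDerivWithinAt (fun y : ℝ => (Real.cos (k * y) : ℂ)) _ s x :=
    fun x => (hlin x).cos.ofReal_comp.hasDerivWithinAt
  have hsin : ∀ x : ℝ, HasDerivWithinAt (fun y : ℝ => (Real.sin (k * y) : ℂ)) _ s x :=
    fun x => (hlin x).sin.ofReal_comp.hasDerivWithinAt
  have hP : ∀ x ∈ s, HasDerivWithinAt (fun y : ℝ => u y * (Real.cos (k * y) : ℂ) -
      derivWithin u s y / k * (Real.sin (k * y) : ℂ)) 0 s x := fun x hx => by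
    have h := (((hu.1 x hx).hasDerivWithinAt.mul (hcos x)).sub
      (((hu.2 x hx).div_const (k : ℂ)).mul (hsin x)))
    refine h.congr_deriv ?_
    push_cast
    field_simp
    ring
  have hQ : ∀ x ∈ s, HasDerivWithinAt (fun y : ℝ => u y * (Real.sin (k * y) : ℂ) +
      derivWithin u s y / k * (Real.cos (k * y) : ℂ)) 0 s x := fun x hx => by
    have h := (((hu.1 x hx).hasDerivWithinAt.mul (hsin x)).add
      (((hu.2 x hx).div_const (k : ℂ)).mul (hcos x)))
    refine h.congr_deriv ?_
    push_cast
    field_simp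
    ring
  refine ⟨u 0, derivWithin u s 0 / k, fun x hx => ?_⟩
  have h1 := eq_of_hasDerivWithinAt_zero hconv hP hx h0
  have h2 := eq_of_hasDerivWithinAt_zero hconv hQ hx h0
  have h3 : (Real.sin (k * x) : ℂ) ^ 2 + (Real.cos (k * x) : ℂ) ^ 2 = 1 := by
    exact_mod_cast Real.sin_sq_add_cos_sq (k * x)
  simp only [mul_zero, Real.cos_zero, Real.sin_zero, Complex.ofReal_one, Complex.ofReal_zero,
    mul_one, sub_zero, zero_add] at h1 h2
  simp only [wave]
  linear_combination (Real.cos (k * x) : ℂ) * h1 + (Real.sin (k * x) : ℂ) * h2 - u x * h3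

lemma wave_coeff_unique {k : ℝ} (hk : k ≠ 0) {s : Set ℝ} (h0 : (0 : ℝ) ∈ s)
    (hs : UniqueDiffWithinAt ℝ s 0) {A B A' B' : ℂ}
    (h : EqOn (wave k A B) (wave k A' B') s) : A = A' ∧ B = B' := by
  have hkC : (k : ℂ) ≠ 0 := by exact_mod_cast hk
  refine ⟨by simpa using h h0, ?_⟩
  have h1 := derivWithin_congr h (h h0)
  rw [derivWithin_wave hs, derivWithin_wave hs, wave_zero, wave_zero] at h1
  exact mul_left_cancel₀ hkC h1

lemma wave_eqOn_zero {k : ℝ} (hk : k ≠ 0) {s : Set ℝ} (h0 : (0 : ℝ) ∈ s)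
    (hs : UniqueDiffWithinAt ℝ s 0) {A B : ℂ} (h : ∀ x ∈ s, wave k A B x = 0) :
    A = 0 ∧ B = 0 :=
  wave_coeff_unique hk h0 hs (fun x hx => by rw [h x hx]; simp [wave])

lemma conj_wave (k : ℝ) (A B : ℂ) (x : ℝ) :
    (starRingEnd ℂ) (wave k A B x) = wave k ((starRingEnd ℂ) A) ((starRingEnd ℂ) B) x := by
  simp only [wave, map_add, map_mul, Complex.conj_ofReal]

lemma wave_ofReal_eq_zero_iff (k u v x : ℝ) :
    wave k u v x = 0 ↔ u * Real.cos (k * x) + v * Real.sin (k * x) = 0 := by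
  simp only [wave]
  norm_cast

/-- A real wave has a zero on every half-period, hence on the half-line. -/
lemma exists_wave_zero {k : ℝ} (hk : k ≠ 0) (u v : ℝ) :
    ∃ x, 0 ≤ x ∧ u * Real.cos (k * x) + v * Real.sin (k * x) = 0 := by
  have hcont : ContinuousOn (fun x : ℝ => u * Real.cos (k * x) + v * Real.sin (k * x))
      (uIcc 0 (Real.pi / |k|)) := by fun_prop
  have hend : u * Real.cos (k * (Real.pi / |k|)) + v * Real.sin (k * (Real.pi / |k|)) = -u := by
    rcases lt_or_gt_of_ne hk with h | h
    · rw [abs_of_neg h, show k * (Real.pi / -k) = -Real.pi by field_simp]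
      simp
    · rw [abs_of_pos h, show k * (Real.pi / k) = Real.pi by field_simp]
      simp
  have hmem : (0 : ℝ) ∈ uIcc ((fun x : ℝ => u * Real.cos (k * x) + v * Real.sin (k * x)) 0)
      ((fun x : ℝ => u * Real.cos (k * x) + v * Real.sin (k * x)) (Real.pi / |k|)) := by
    simp only [hend, mul_zero, Real.cos_zero, Real.sin_zero, mul_one, add_zero, mem_uIcc]
    rcases le_total u 0 with h | h
    · exact Or.inl ⟨h, by linarith⟩
    · exact Or.inr ⟨by linarith, h⟩
  obtain ⟨x, hx, hx0⟩ := intermediate_value_uIcc hcont hmem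
  rw [uIcc_of_le (by positivity)] at hx
  exact ⟨x, hx.1, hx0⟩

/-- If the coefficient vectors of two real waves are orthogonal and nonzero, then the zeros of the
first wave are the zeros of the derivative of the second. -/
lemma wave_zero_iff_of_orthogonal {u₀ v₀ u₁ v₁ c s : ℝ} (h : u₀ * u₁ + v₀ * v₁ = 0)
    (h₀ : ¬ (u₀ = 0 ∧ v₀ = 0)) (h₁ : ¬ (u₁ = 0 ∧ v₁ = 0)) :
    u₀ * c + v₀ * s = 0 ↔ v₁ * c + -u₁ * s = 0 := by
  constructor <;> intro hx <;> by_contra hne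
  · refine h₀ ⟨(mul_eq_zero.1 ?_).resolve_right hne, (mul_eq_zero.1 ?_).resolve_right hne⟩
    · linear_combination v₁ * hx - s * h
    · linear_combination -u₁ * hx + c * h
  · refine h₁ ⟨(mul_eq_zero.1 ?_).resolve_right hne, (mul_eq_zero.1 ?_).resolve_right hne⟩
    · linear_combination -v₀ * hx + c * h
    · linear_combination u₀ * hx + s * h

/-! ### The arithmetic condition on the edge lengths -/

lemma not_cos_eq_zero_and {b c k : ℝ} (hk : k ≠ 0) (hbc : Irrational (b / c)) :
    ¬ (Real.cos (k * b) = 0 ∧ Real.cos (k * c) = 0) := by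
  rintro ⟨h1, h2⟩
  obtain ⟨m, hm⟩ := Real.cos_eq_zero_iff.1 h1
  obtain ⟨n, hn⟩ := Real.cos_eq_zero_iff.1 h2
  refine hbc ⟨(2 * m + 1) / (2 * n + 1), ?_⟩
  rw [← mul_div_mul_left b c hk, hm, hn, div_div_div_cancel_right₀ two_ne_zero,
    mul_div_mul_right _ _ Real.pi_ne_zero]
  push_cast
  rfl

lemma not_sin_eq_zero_and {b c k : ℝ} (hk : k ≠ 0) (hbc : Irrational (b / c)) :
    ¬ (Real.sin (k * b) = 0 ∧ Real.sin (k * c) = 0) := by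
  rintro ⟨h1, h2⟩
  obtain ⟨m, hm⟩ := Real.sin_eq_zero_iff.1 h1
  obtain ⟨n, hn⟩ := Real.sin_eq_zero_iff.1 h2
  refine hbc ⟨m / n, ?_⟩
  rw [← mul_div_mul_left b c hk, ← hm, ← hn, mul_div_mul_right _ _ Real.pi_ne_zero]
  push_cast
  rfl

/-- The squared amplitude on the leads of the reflection-even solution with parameter `t = 1`. -/
noncomputable def evenSq (b c k : ℝ) : ℝ :=
  (Real.cos (k * b) * Real.cos (k * c)) ^ 2 + Real.sin (k * b + k * c) ^ 2

/-- The squared amplitude on the leads of the reflection-odd solution with parameter `s = 1`. -/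
noncomputable def oddSq (b c k : ℝ) : ℝ :=
  (Real.sin (k * b) * Real.sin (k * c)) ^ 2 + Real.sin (k * b + k * c) ^ 2

/-- If the sine of a sum and one of the two products in the cosine of the sum vanish, then so do
both products in the sine of the sum. -/
lemma sin_mul_cos_eq_zero {x y : ℝ} (h : Real.sin (x + y) = 0)
    (h' : Real.cos x * Real.cos y = 0 ∨ Real.sin x * Real.sin y = 0) :
    Real.sin x * Real.cos y = 0 ∧ Real.cos x * Real.sin y = 0 := by
  rw [Real.sin_add] at h
  have hprod : (Real.sin x * Real.cos y) * (Real.cos x * Real.sin y) = 0 := by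
    rcases h' with h' | h'
    · linear_combination Real.sin x * Real.sin y * h'
    · linear_combination Real.cos x * Real.cos y * h'
  rcases mul_eq_zero.1 hprod with h1 | h1
  · exact ⟨h1, by linarith⟩
  · exact ⟨by linarith, h1⟩

lemma evenSq_pos {b c k : ℝ} (hk : k ≠ 0) (hbc : Irrational (b / c)) : 0 < evenSq b c k := by
  refine lt_of_le_of_ne (by unfold evenSq; positivity) fun h => ?_
  obtain ⟨h1, h2⟩ := (add_eq_zero_iff_of_nonneg (sq_nonneg _) (sq_nonneg _)).1 h.symm
  rw [sq_eq_zero_iff] at h1 h2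
  obtain ⟨h3, h4⟩ := sin_mul_cos_eq_zero h2 (Or.inl h1)
  refine not_cos_eq_zero_and hk hbc ⟨?_, ?_⟩
  · linear_combination -Real.cos (k * b) * Real.sin_sq_add_cos_sq (k * c) +
      Real.sin (k * c) * h4 + Real.cos (k * c) * h1
  · linear_combination -Real.cos (k * c) * Real.sin_sq_add_cos_sq (k * b) +
      Real.sin (k * b) * h3 + Real.cos (k * b) * h1

lemma oddSq_pos {b c k : ℝ} (hk : k ≠ 0) (hbc : Irrational (b / c)) : 0 < oddSq b c k := by
  refine lt_of_le_of_ne (by unfold oddSq; positivity) fun h => ?_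
  obtain ⟨h1, h2⟩ := (add_eq_zero_iff_of_nonneg (sq_nonneg _) (sq_nonneg _)).1 h.symm
  rw [sq_eq_zero_iff] at h1 h2
  obtain ⟨h3, h4⟩ := sin_mul_cos_eq_zero h2 (Or.inr h1)
  refine not_sin_eq_zero_and hk hbc ⟨?_, ?_⟩
  · linear_combination -Real.sin (k * b) * Real.sin_sq_add_cos_sq (k * c) +
      Real.cos (k * c) * h3 + Real.sin (k * c) * h1
  · linear_combination -Real.sin (k * c) * Real.sin_sq_add_cos_sq (k * b) +
      Real.cos (k * b) * h4 + Real.sin (k * b) * h1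

/-! ### The two-parameter family of solutions on the graph -/

/-- Half of the lengths of the edges of the cycle. -/
def half (b c : ℝ) : Fin 2 → ℝ := ![b, c]

lemma edgeLength_eq (b c : ℝ) (i : Fin 2) : edgeLength b c i = 2 * half b c i := by
  fin_cases i <;> simp [edgeLength, half]

lemma edgeLength_pos {b c : ℝ} (hb : 0 < b) (hc : 0 < c) (i : Fin 2) : 0 < edgeLength b c i := by
  fin_cases i <;> simp [edgeLength, hb, hc]

/-- The solution on an edge of length `2 * h` whose even part about the midpoint is
`t cos (k h') cos (k (x - h))` and whose odd part is `s sin (k h') sin (k (h - x))`, where `h'` is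
half of the length of the other edge.  With these weights the end values on the two edges
agree. -/
noncomputable def edgeWave (k h h' : ℝ) (t s : ℂ) (x : ℝ) : ℂ :=
  t * (Real.cos (k * h') : ℂ) * (Real.cos (k * (x - h)) : ℂ) +
    s * (Real.sin (k * h') : ℂ) * (Real.sin (k * (h - x)) : ℂ)

lemma edgeWave_eq_wave (k h h' : ℝ) (t s : ℂ) :
    edgeWave k h h' t s =
      wave k (t * (Real.cos (k * h') : ℂ) * (Real.cos (k * h) : ℂ) +
          s * (Real.sin (k * h') : ℂ) * (Real.sin (k * h) : ℂ))
        (t * (Real.cos (k * h') : ℂ) * (Real.sin (k * h) : ℂ) -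
          s * (Real.sin (k * h') : ℂ) * (Real.cos (k * h) : ℂ)) := by
  funext x
  simp only [edgeWave, wave, mul_sub, Real.cos_sub, Real.sin_sub]
  push_cast
  ring

/-- The coefficient of `cos (k x)` on lead `0` of the solution with parameters `t`, `s`. -/
noncomputable def leadCos (b c k : ℝ) (t s : ℂ) : ℂ :=
  t * ((Real.cos (k * b) * Real.cos (k * c) : ℝ) : ℂ) +
    s * ((Real.sin (k * b) * Real.sin (k * c) : ℝ) : ℂ)

/-- The coefficient of `sin (k x)` on lead `0` of the solution with parameters `t`, `s`. -/
noncomputable def leadSin (b c k : ℝ) (t s : ℂ) : ℂ :=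
  (s - t) * (Real.sin (k * b + k * c) : ℂ)

/-- The solution of the equation and of the vertex conditions whose part even under the reflection
has parameter `t` and whose odd part has parameter `s`.  On lead `1` the sign of the odd part
is reversed. -/
noncomputable def standing (b c k : ℝ) (t s : ℂ) : GraphFun where
  edge i := edgeWave k (half b c i) (half b c i.rev) t s
  lead j := wave k (leadCos b c k t (![s, -s] j)) (leadSin b c k t (![s, -s] j))

lemma standing_lead_zero (b c k : ℝ) (t s : ℂ) :
    (standing b c k t s).lead 0 = wave k (leadCos b c k t s) (leadSin b c k t s) := rfl

lemma standing_lead_one (b c k : ℝ) (t s : ℂ) :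
    (standing b c k t s).lead 1 = wave k (leadCos b c k t (-s)) (leadSin b c k t (-s)) := rfl

lemma scale_standing (b c k : ℝ) (z t s : ℂ) :
    (standing b c k t s).scale z = standing b c k (z * t) (z * s) := by
  simp only [GraphFun.scale, standing, GraphFun.mk.injEq]
  refine ⟨?_, ?_⟩
  · funext i x
    simp only [edgeWave]
    ring
  · funext j x
    fin_cases j <;> simp [wave, leadCos, leadSin] <;> ring

lemma reflect_standing (b c k : ℝ) (t s : ℂ) :
    (standing b c k t s).reflect b c = standing b c k t (-s) := by
  simp only [GraphFun.reflect, standing, GraphFun.mk.injEq]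
  refine ⟨?_, ?_⟩
  · funext i x
    have h1 : k * (edgeLength b c i - x - half b c i) = -(k * (x - half b c i)) := by
      rw [edgeLength_eq]; ring
    have h2 : k * (half b c i - (edgeLength b c i - x)) = -(k * (half b c i - x)) := by
      rw [edgeLength_eq]; ring
    simp only [edgeWave, h1, h2, Real.cos_neg, Real.sin_neg]
    push_cast
    ring
  · funext j x
    fin_cases j <;> simp

lemma standing_zero (b c k : ℝ) : standing b c k 0 0 = GraphFun.zero := by
  have h := scale_standing b c k 0 0 0
  rw [mul_zero] at h
  rw [← h]
  simp [GraphFun.scale, GraphFun.zero]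

lemma Agree.refl (b c : ℝ) (S : Set ℝ) (f : GraphFun) : Agree b c S f f :=
  ⟨fun _ => eqOn_refl _ _, fun _ => eqOn_refl _ _⟩

lemma Agree.symm {b c : ℝ} {S : Set ℝ} {f g : GraphFun} (h : Agree b c S f g) :
    Agree b c S g f :=
  ⟨fun i => (h.1 i).symm, fun j => (h.2 j).symm⟩

lemma Agree.trans {b c : ℝ} {S : Set ℝ} {f g h : GraphFun} (h₁ : Agree b c S f g)
    (h₂ : Agree b c S g h) : Agree b c S f h :=
  ⟨fun i => (h₁.1 i).trans (h₂.1 i), fun j => (h₁.2 j).trans (h₂.2 j)⟩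

lemma Agree.mono {b c : ℝ} {S T : Set ℝ} {f g : GraphFun} (h : Agree b c S f g) (hT : T ⊆ S) :
    Agree b c T f g :=
  ⟨h.1, fun j => (h.2 j).mono hT⟩

lemma Agree.scale {b c : ℝ} {S : Set ℝ} {f g : GraphFun} (h : Agree b c S f g) (z : ℂ) :
    Agree b c S (f.scale z) (g.scale z) :=
  ⟨fun i _ hx => congrArg (z * ·) (h.1 i hx), fun j _ hx => congrArg (z * ·) (h.2 j hx)⟩

lemma Agree.reflect {b c : ℝ} {S : Set ℝ} {f g : GraphFun} (h : Agree b c S f g) :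
    Agree b c S (f.reflect b c) (g.reflect b c) :=
  ⟨fun i x hx => h.1 i ⟨by linarith [hx.2], by linarith [hx.1]⟩, fun j _ hx => h.2 j.rev hx⟩

lemma SolvesGraph.congr {b c lam : ℝ} {S : Set ℝ} (hb : 0 < b) (hc : 0 < c) (h0 : (0 : ℝ) ∈ S)
    {f g : GraphFun} (hg : SolvesGraph b c S lam g) (h : Agree b c S f g) :
    SolvesGraph b c S lam f := by
  have hl : ∀ i, (0 : ℝ) ∈ Icc 0 (edgeLength b c i) := fun i =>
    left_mem_Icc.2 (edgeLength_pos hb hc i).le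
  have hr : ∀ i, edgeLength b c i ∈ Icc 0 (edgeLength b c i) := fun i =>
    right_mem_Icc.2 (edgeLength_pos hb hc i).le
  refine ⟨fun i => (hg.edge_eq i).congr (h.1 i), fun j => (hg.lead_eq j).congr (h.2 j),
    fun i => ?_, fun i => ?_, ?_, ?_⟩
  · rw [h.1 i (hl i), h.2 0 h0, hg.cont_zero]
  · rw [h.1 i (hr i), h.2 1 h0, hg.cont_one]
  · rw [derivWithin_congr (h.2 0) (h.2 0 h0),
      Finset.sum_congr rfl fun i _ => derivWithin_congr (h.1 i) (h.1 i (hl i)), hg.deriv_zero]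
  · rw [derivWithin_congr (h.2 1) (h.2 1 h0),
      Finset.sum_congr rfl fun i _ =>
        congrArg Neg.neg (derivWithin_congr (h.1 i) (h.1 i (hr i))), hg.deriv_one]

lemma solvesGraph_standing {b c : ℝ} (hb : 0 < b) (hc : 0 < c) (k : ℝ) {S : Set ℝ}
    (hS : UniqueDiffOn ℝ S) (h0 : (0 : ℝ) ∈ S) (t s : ℂ) :
    SolvesGraph b c S (k ^ 2) (standing b c k t s) := by
  have hE : ∀ i, UniqueDiffOn ℝ (Icc 0 (edgeLength b c i)) := fun i =>
    uniqueDiffOn_Icc (edgeLength_pos hb hc i)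
  have hl : ∀ i, (0 : ℝ) ∈ Icc 0 (edgeLength b c i) := fun i =>
    left_mem_Icc.2 (edgeLength_pos hb hc i).le
  have hr : ∀ i, edgeLength b c i ∈ Icc 0 (edgeLength b c i) := fun i =>
    right_mem_Icc.2 (edgeLength_pos hb hc i).le
  have hd : ∀ i, ∀ x ∈ Icc 0 (edgeLength b c i),
      derivWithin ((standing b c k t s).edge i) (Icc 0 (edgeLength b c i)) x =
        k * (t * (Real.cos (k * half b c i.rev) : ℂ) * (Real.sin (k * (half b c i - x)) : ℂ) -
          s * (Real.sin (k * half b c i.rev) : ℂ) * (Real.cos (k * (half b c i - x)) : ℂ)) := by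
    intro i x hx
    simp only [standing, edgeWave_eq_wave]
    rw [derivWithin_wave (hE i x hx)]
    simp only [wave, mul_sub k, Real.cos_sub, Real.sin_sub]
    push_cast
    ring
  refine ⟨fun i => ?_, fun j => solvesOn_wave hS _ _ _, fun i => ?_, fun i => ?_, ?_, ?_⟩
  · simp only [standing, edgeWave_eq_wave]
    exact solvesOn_wave (hE i) _ _ _
  · rw [standing_lead_zero, wave_zero]
    fin_cases i <;> simp [standing, edgeWave, half, leadCos] <;> ring
  · have h : k * (half b c i - 2 * half b c i) = -(k * half b c i) := by ring
    have h' : k * (2 * half b c i - half b c i) = k * half b c i := by ring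
    rw [standing_lead_one, wave_zero]
    simp only [standing, edgeWave, leadCos, edgeLength_eq, h, h', Real.sin_neg]
    fin_cases i <;> simp [half] <;> ring
  · rw [standing_lead_zero, derivWithin_wave (hS 0 h0), wave_zero, Fin.sum_univ_two,
      hd 0 0 (hl 0), hd 1 0 (hl 1)]
    simp [half, leadSin, Complex.sin_add]
    ring
  · have h : ∀ i, k * (half b c i - 2 * half b c i) = -(k * half b c i) := fun i => by ring
    rw [standing_lead_one, derivWithin_wave (hS 0 h0), wave_zero, Fin.sum_univ_two,
      hd 0 _ (hr 0), hd 1 _ (hr 1)]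
    simp only [edgeLength_eq, h]
    simp [half, leadSin, Complex.sin_add]
    ring

lemma exists_smul_of_mul_eq_mul {α β x y : ℂ} (h : ¬ (α = 0 ∧ β = 0)) (hxy : x * α = y * β) :
    ∃ t, x = t * β ∧ y = t * α := by
  by_cases hα : α = 0
  · have hβ : β ≠ 0 := fun hβ => h ⟨hα, hβ⟩
    refine ⟨x / β, by field_simp, ?_⟩
    rw [hα, mul_zero] at hxy ⊢
    exact (mul_eq_zero.1 hxy.symm).resolve_right hβ
  · refine ⟨y / α, ?_, by field_simp⟩
    field_simp
    exact hxy

/-- For `k ≠ 0`, all solutions on the graph belong to the family `standing`.  The even and the odd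
part of a solution on an edge have amplitudes `p`, `q`; continuity at the vertices determines the
ratios of the two values of `p` and of the two values of `q`, because neither the two cosines nor
the two sines vanish together. -/
lemma SolvesGraph.exists_standing {b c k : ℝ} (hb : 0 < b) (hc : 0 < c) (hk : k ≠ 0)
    (hbc : Irrational (b / c)) {S : Set ℝ} (hconv : Convex ℝ S) (hS : UniqueDiffOn ℝ S)
    (h0 : (0 : ℝ) ∈ S) {f : GraphFun} (hf : SolvesGraph b c S (k ^ 2) f) :
    ∃ t s : ℂ, Agree b c S f (standing b c k t s) := by
  have hkC : (k : ℂ) ≠ 0 := by exact_mod_cast hk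
  have hE : ∀ i, UniqueDiffOn ℝ (Icc 0 (edgeLength b c i)) := fun i =>
    uniqueDiffOn_Icc (edgeLength_pos hb hc i)
  have hl : ∀ i, (0 : ℝ) ∈ Icc 0 (edgeLength b c i) := fun i =>
    left_mem_Icc.2 (edgeLength_pos hb hc i).le
  have hr : ∀ i, edgeLength b c i ∈ Icc 0 (edgeLength b c i) := fun i =>
    right_mem_Icc.2 (edgeLength_pos hb hc i).le
  choose P Q hPQ using fun i => (hf.edge_eq i).exists_wave hk (convex_Icc _ _) (hl i)
  choose A B hAB using fun j => (hf.lead_eq j).exists_wave hk hconv h0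
  have hc0 : ∀ i, P i = A 0 := fun i => by
    simpa [hPQ i (hl i), hAB 0 h0] using hf.cont_zero i
  have hc1 : ∀ i, wave k (P i) (Q i) (edgeLength b c i) = A 1 := fun i => by
    simpa [hPQ i (hr i), hAB 1 h0] using hf.cont_one i
  have hd0 : B 0 + ∑ i, Q i = 0 := by
    have h := hf.deriv_zero
    rw [derivWithin_congr (hAB 0) (hAB 0 h0), derivWithin_wave (hS 0 h0), wave_zero,
      Finset.sum_congr rfl fun i _ => (derivWithin_congr (hPQ i) (hPQ i (hl i))).trans
        ((derivWithin_wave (hE i 0 (hl i)) _ _ _).trans (by rw [wave_zero])),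
      ← Finset.mul_sum, ← mul_add] at h
    exact (mul_eq_zero.1 h).resolve_left hkC
  have hd1 : B 1 - ∑ i, wave k (Q i) (-P i) (edgeLength b c i) = 0 := by
    have h := hf.deriv_one
    rw [derivWithin_congr (hAB 1) (hAB 1 h0), derivWithin_wave (hS 0 h0), wave_zero,
      Finset.sum_neg_distrib,
      Finset.sum_congr rfl fun i _ => (derivWithin_congr (hPQ i) (hPQ i (hr i))).trans
        (derivWithin_wave (hE i _ (hr i)) _ _ _),
      ← Finset.mul_sum, ← sub_eq_add_neg, ← mul_sub] at h
    exact (mul_eq_zero.1 h).resolve_left hkC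
  have hcos := fun i => Real.cos_two_mul (k * half b c i)
  have hsin := fun i => Real.sin_two_mul (k * half b c i)
  have h2 : ∀ i, k * (2 * half b c i) = 2 * (k * half b c i) := fun i => by ring
  simp only [wave, edgeLength_eq, h2, hcos, hsin] at hc1 hd1
  rw [Fin.sum_univ_two] at hd0 hd1
  have hc10 := hc1 0
  have hc11 := hc1 1
  rw [hc0] at hc10 hc11
  rw [hc0, hc0] at hd1
  have hP0 := hc0 0
  have hP1 := hc0 1
  simp only [half, Matrix.cons_val_zero, Matrix.cons_val_one] at hc10 hc11 hd1
  have hncos : ¬ ((Real.cos (k * b) : ℂ) = 0 ∧ (Real.cos (k * c) : ℂ) = 0) := by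
    exact_mod_cast not_cos_eq_zero_and hk hbc
  have hnsin : ¬ ((Real.sin (k * b) : ℂ) = 0 ∧ (Real.sin (k * c) : ℂ) = 0) := by
    exact_mod_cast not_sin_eq_zero_and hk hbc
  have hb1 : (Real.sin (k * b) : ℂ) ^ 2 + (Real.cos (k * b) : ℂ) ^ 2 = 1 := by
    exact_mod_cast Real.sin_sq_add_cos_sq (k * b)
  have hc1' : (Real.sin (k * c) : ℂ) ^ 2 + (Real.cos (k * c) : ℂ) ^ 2 = 1 := by
    exact_mod_cast Real.sin_sq_add_cos_sq (k * c)
  simp only [Complex.ofReal_sub, Complex.ofReal_mul, Complex.ofReal_pow, Complex.ofReal_one,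
    Complex.ofReal_ofNat] at hc10 hc11 hd1
  -- It remains to find `t`, `s` that give the coefficients of all four waves.
  suffices h : ∃ t s : ℂ,
      (A 0 = t * Real.cos (k * c) * Real.cos (k * b) + s * Real.sin (k * c) * Real.sin (k * b) ∧
      Q 0 = t * Real.cos (k * c) * Real.sin (k * b) - s * Real.sin (k * c) * Real.cos (k * b) ∧
      Q 1 = t * Real.cos (k * b) * Real.sin (k * c) - s * Real.sin (k * b) * Real.cos (k * c)) ∧
      A 1 = t * Real.cos (k * c) * Real.cos (k * b) - s * Real.sin (k * c) * Real.sin (k * b) ∧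
      B 0 = leadSin b c k t s ∧ B 1 = leadSin b c k t (-s) by
    obtain ⟨t, s, ⟨h1, h2, h3⟩, h4, h5, h6⟩ := h
    refine ⟨t, s, fun i => (hPQ i).trans ?_, fun j => (hAB j).trans ?_⟩
    · simp only [standing, edgeWave_eq_wave]
      fin_cases i
      · simp only [Fin.zero_eta, hP0, h1, h2]
        exact eqOn_refl _ _
      · have h1' : A 0 = t * Real.cos (k * b) * Real.cos (k * c) +
            s * Real.sin (k * b) * Real.sin (k * c) := h1.trans (by ring)
        simp only [Fin.mk_one, hP1, h1', h3]
        exact eqOn_refl _ _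
    · intro x _
      fin_cases j
      · simp only [Fin.zero_eta, standing_lead_zero, ← h5, h1, leadCos, wave]
        push_cast
        ring
      · simp only [Fin.mk_one, standing_lead_one, ← h6, h4, leadCos, wave]
        push_cast
        ring
  simp only [leadSin, Real.sin_add, Complex.ofReal_add, Complex.ofReal_mul]
  generalize (Real.cos (k * b) : ℂ) = cb at *
  generalize (Real.cos (k * c) : ℂ) = cc at *
  generalize (Real.sin (k * b) : ℂ) = sb at *
  generalize (Real.sin (k * c) : ℂ) = sc at *
  obtain ⟨t, ht0, ht1⟩ := exists_smul_of_mul_eq_mul (x := A 0 * cb + Q 0 * sb)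
    (y := A 0 * cc + Q 1 * sc) hncos (by linear_combination (hc10 - hc11) / 2)
  obtain ⟨s, hs0, hs1⟩ := exists_smul_of_mul_eq_mul (x := A 0 * sb - Q 0 * cb)
    (y := A 0 * sc - Q 1 * cc) hnsin (by
      linear_combination (hc11 - hc10) / 2 + A 0 * hb1 - A 0 * hc1')
  have hA0 : A 0 = t * cc * cb + s * sc * sb := by
    linear_combination cb * ht0 + sb * hs0 - A 0 * hb1
  have hQ0 : Q 0 = t * cc * sb - s * sc * cb := by
    linear_combination sb * ht0 - cb * hs0 - Q 0 * hb1
  have hQ1 : Q 1 = t * cb * sc - s * sb * cc := by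
    linear_combination sc * ht1 - cc * hs1 - Q 1 * hc1'
  refine ⟨t, s, ⟨hA0, hQ0, hQ1⟩, ?_, ?_, ?_⟩
  · linear_combination -hc10 + 2 * cb * ht0 - hA0
  · linear_combination hd0 - hQ0 - hQ1
  · linear_combination hd1 - 2 * cb * hs0 - 2 * cc * hs1 - hQ0 - hQ1

/-! ### Contra-phasal solutions -/

/-- The parameters of a solution are determined by its values on the leads: two nonzero vectors
`S`, `T` of lead coefficients enter as `t • S + s • T` and `t • S - s • T`. -/
lemma eq_zero_of_leads_eq_zero {b c k : ℝ} (hk : k ≠ 0) (hbc : Irrational (b / c)) {S : Set ℝ}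
    (hS : UniqueDiffOn ℝ S) (h0 : (0 : ℝ) ∈ S) {t s : ℂ}
    (h : ∀ j, ∀ x ∈ S, (standing b c k t s).lead j x = 0) : t = 0 ∧ s = 0 := by
  obtain ⟨hu0, hv0⟩ := wave_eqOn_zero hk h0 (hS 0 h0) (h 0)
  obtain ⟨hu1, hv1⟩ := wave_eqOn_zero hk h0 (hS 0 h0) (h 1)
  simp only [Matrix.cons_val_zero, Matrix.cons_val_one, leadCos, leadSin] at hu0 hv0 hu1 hv1
  have hE : (evenSq b c k : ℂ) ≠ 0 := by exact_mod_cast (evenSq_pos hk hbc).ne'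
  have hO : (oddSq b c k : ℂ) ≠ 0 := by exact_mod_cast (oddSq_pos hk hbc).ne'
  constructor
  · refine (mul_eq_zero.1 ?_).resolve_right hE
    simp only [evenSq, Complex.ofReal_add, Complex.ofReal_pow]
    linear_combination ((Real.cos (k * b) * Real.cos (k * c) : ℝ) : ℂ) * (hu0 + hu1) / 2 -
      (Real.sin (k * b + k * c) : ℂ) * (hv0 + hv1) / 2
  · refine (mul_eq_zero.1 ?_).resolve_right hO
    simp only [oddSq, Complex.ofReal_add, Complex.ofReal_pow]
    linear_combination ((Real.sin (k * b) * Real.sin (k * c) : ℝ) : ℂ) * (hu0 - hu1) / 2 +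
      (Real.sin (k * b + k * c) : ℂ) * (hv0 - hv1) / 2

lemma conj_eq_of_real_leads {b c k : ℝ} (hk : k ≠ 0) (hbc : Irrational (b / c)) {t s : ℂ}
    (h : ∀ j, ∀ x ∈ Ici (0 : ℝ), (starRingEnd ℂ) ((standing b c k t s).lead j x) =
      (standing b c k t s).lead j x) :
    (starRingEnd ℂ) t = t ∧ (starRingEnd ℂ) s = s := by
  have hz : ∀ j, ∀ x ∈ Ici (0 : ℝ), (standing b c k ((starRingEnd ℂ) t - t)
      ((starRingEnd ℂ) s - s)).lead j x = 0 := fun j x hx => by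
    have hjx := sub_eq_zero.2 (h j x hx)
    fin_cases j <;>
      simp only [Fin.zero_eta, Fin.mk_one, standing_lead_zero, standing_lead_one, wave, leadCos,
        leadSin, map_add, map_sub, map_mul, map_neg, Complex.conj_ofReal] at hjx ⊢ <;>
      linear_combination hjx
  obtain ⟨h1, h2⟩ := eq_zero_of_leads_eq_zero hk hbc (uniqueDiffOn_Ici 0) self_mem_Ici hz
  exact ⟨sub_eq_zero.1 h1, sub_eq_zero.1 h2⟩

/-- On the leads of a solution with real parameters the two waves have orthogonal coefficient
vectors `t • S ± s • T` exactly if `t² |S|² = s² |T|²`. -/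
lemma lead_orthogonality (b c k t s : ℝ) :
    (t * (Real.cos (k * b) * Real.cos (k * c)) + s * (Real.sin (k * b) * Real.sin (k * c))) *
        (t * (Real.cos (k * b) * Real.cos (k * c)) + -s * (Real.sin (k * b) * Real.sin (k * c))) +
      ((s - t) * Real.sin (k * b + k * c)) * ((-s - t) * Real.sin (k * b + k * c)) =
      t ^ 2 * evenSq b c k - s ^ 2 * oddSq b c k := by
  unfold evenSq oddSq
  ring

lemma leadCos_ofReal (b c k t s : ℝ) :
    leadCos b c k t s = ((t * (Real.cos (k * b) * Real.cos (k * c)) +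
      s * (Real.sin (k * b) * Real.sin (k * c)) : ℝ) : ℂ) := by
  simp only [leadCos]
  push_cast
  ring

lemma leadSin_ofReal (b c k t s : ℝ) :
    leadSin b c k t s = (((s - t) * Real.sin (k * b + k * c) : ℝ) : ℂ) := by
  simp only [leadSin]
  push_cast
  ring

/-- For functions that agree with real waves on the leads, the condition on the zeros says that the
coefficient vectors of these waves are orthogonal. If one of the vectors is zero, both sides
hold. -/
lemma contra_iff_orthogonal {k : ℝ} (hk : k ≠ 0) {f : GraphFun} {u v : Fin 2 → ℝ}
    (hf : ∀ j, EqOn (f.lead j) (wave k (u j) (v j)) (Ici 0)) :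
    ((∀ j, ∃ x ∈ Ici (0 : ℝ), f.lead j x ≠ 0) →
      f.leadZeros 0 = f.leadDerivZeros 1 ∧ f.leadZeros 1 = f.leadDerivZeros 0) ↔
      u 0 * u 1 + v 0 * v 1 = 0 := by
  have hkC : (k : ℂ) ≠ 0 := by exact_mod_cast hk
  have hval : ∀ j, ∀ x : ℝ, 0 ≤ x → (f.lead j x = 0 ↔
      u j * Real.cos (k * x) + v j * Real.sin (k * x) = 0) := fun j x hx => by
    rw [hf j hx, wave_ofReal_eq_zero_iff]
  have hder : ∀ j, ∀ x : ℝ, 0 ≤ x → (derivWithin (f.lead j) (Ici 0) x = 0 ↔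
      v j * Real.cos (k * x) + -u j * Real.sin (k * x) = 0) := fun j x hx => by
    rw [derivWithin_congr (hf j) (hf j hx), derivWithin_wave (uniqueDiffOn_Ici 0 x hx),
      mul_eq_zero, or_iff_right hkC, ← Complex.ofReal_neg, wave_ofReal_eq_zero_iff]
  have hne : ∀ j, (∃ x ∈ Ici (0 : ℝ), f.lead j x ≠ 0) ↔ ¬ (u j = 0 ∧ v j = 0) := fun j => by
    constructor
    · rintro ⟨x, hx, hfx⟩ ⟨hu, hv⟩
      exact hfx ((hval j x hx).2 (by simp [hu, hv]))
    · intro h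
      by_contra! hz
      obtain ⟨h1, h2⟩ := wave_eqOn_zero hk self_mem_Ici (uniqueDiffOn_Ici 0 0 self_mem_Ici)
        fun x hx => (hf j hx).symm.trans (hz x hx)
      exact h ⟨by exact_mod_cast h1, by exact_mod_cast h2⟩
  constructor
  · intro h
    by_cases hnz : ∀ j, ¬ (u j = 0 ∧ v j = 0)
    · obtain ⟨x, hx, hx0⟩ := exists_wave_zero hk (u 0) (v 0)
      have hx1 : x ∈ f.leadDerivZeros 1 := by
        rw [← (h fun j => (hne j).2 (hnz j)).1]
        exact ⟨hx, (hval 0 x hx).2 hx0⟩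
      have hx1' := (hder 1 x hx).1 hx1.2
      -- The vector `(cos (k x), sin (k x))` is orthogonal to `(u 0, v 0)` and
      -- parallel to `(u 1, v 1)`.
      linear_combination (u 1 * Real.cos (k * x) + v 1 * Real.sin (k * x)) * hx0 +
        (v 0 * Real.cos (k * x) - u 0 * Real.sin (k * x)) * hx1' -
        (u 0 * u 1 + v 0 * v 1) * Real.sin_sq_add_cos_sq (k * x)
    · push Not at hnz
      obtain ⟨j, hu, hv⟩ := hnz
      fin_cases j <;> simp_all
  · intro h hnz
    have h' : u 1 * u 0 + v 1 * v 0 = 0 := by linarith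
    have h0 := (hne 0).1 (hnz 0)
    have h1 := (hne 1).1 (hnz 1)
    constructor <;> ext x <;> refine and_congr_right fun hx => ?_
    · rw [hval 0 x hx, hder 1 x hx]
      exact wave_zero_iff_of_orthogonal h h0 h1
    · rw [hval 1 x hx, hder 0 x hx]
      exact wave_zero_iff_of_orthogonal h' h1 h0

/-- The contra-phasal solutions are the members of the family `standing` with real parameters,
not both zero, for which the even and the odd part have the same amplitude on the leads. -/
lemma isContraPhasal_iff {b c k : ℝ} (hb : 0 < b) (hc : 0 < c) (hk : k ≠ 0)
    (hbc : Irrational (b / c)) {f : GraphFun} :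
    IsContraPhasal b c k f ↔ ∃ t s : ℝ, ¬ (t = 0 ∧ s = 0) ∧
      t ^ 2 * evenSq b c k = s ^ 2 * oddSq b c k ∧
      Agree b c (Ici 0) f (standing b c k t s) := by
  have hwave : ∀ t s : ℝ, Agree b c (Ici 0) f (standing b c k t s) →
      ∀ j, EqOn (f.lead j) (wave k
        ((t * (Real.cos (k * b) * Real.cos (k * c)) +
          ![s, -s] j * (Real.sin (k * b) * Real.sin (k * c)) : ℝ) : ℂ)
        (((![s, -s] j - t) * Real.sin (k * b + k * c) : ℝ) : ℂ)) (Ici 0) := by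
    intro t s h j
    rw [← leadCos_ofReal, ← leadSin_ofReal]
    refine (h.2 j).trans fun x _ => ?_
    fin_cases j <;> simp [standing]
  constructor
  · intro hf
    obtain ⟨t, s, hts⟩ := hf.eigen.solves.exists_standing hb hc hk hbc (convex_Ici 0)
      (uniqueDiffOn_Ici 0) self_mem_Ici
    obtain ⟨ht, hs⟩ := conj_eq_of_real_leads hk hbc (t := t) (s := s) fun j x hx => by
      rw [← hts.2 j hx, hf.real j x hx]
    obtain ⟨t, rfl⟩ := Complex.conj_eq_iff_real.1 ht
    obtain ⟨s, rfl⟩ := Complex.conj_eq_iff_real.1 hs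
    refine ⟨t, s, ?_, ?_, hts⟩
    · rintro ⟨rfl, rfl⟩
      apply hf.eigen.ne_zero
      rwa [Complex.ofReal_zero, standing_zero] at hts
    · have h := (contra_iff_orthogonal hk (hwave t s hts)).1 hf.contra
      rw [← sub_eq_zero, ← lead_orthogonality]
      simpa using h
  · rintro ⟨t, s, hne, hbal, hts⟩
    refine ⟨⟨(solvesGraph_standing hb hc k (uniqueDiffOn_Ici 0) self_mem_Ici t s).congr hb hc
      self_mem_Ici hts, fun h => hne ?_⟩, fun j x hx => ?_, ?_⟩
    · obtain ⟨h1, h2⟩ := eq_zero_of_leads_eq_zero hk hbc (uniqueDiffOn_Ici 0) self_mem_Ici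
        (hts.symm.trans h).2
      exact ⟨by exact_mod_cast h1, by exact_mod_cast h2⟩
    · rw [hwave t s hts j hx, conj_wave, Complex.conj_ofReal, Complex.conj_ofReal]
    · refine (contra_iff_orthogonal hk (hwave t s hts)).2 ?_
      rw [← sub_eq_zero, ← lead_orthogonality] at hbal
      simpa using hbal

lemma isContraPhasal_standing {b c k : ℝ} (hb : 0 < b) (hc : 0 < c) (hk : k ≠ 0)
    (hbc : Irrational (b / c)) :
    IsContraPhasal b c k (standing b c k (√(oddSq b c k) : ℝ) (√(evenSq b c k) : ℝ)) := by
  have hE := evenSq_pos hk hbc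
  have hO := oddSq_pos hk hbc
  refine (isContraPhasal_iff hb hc hk hbc).2 ⟨_, _, fun h => (Real.sqrt_pos.2 hO).ne' h.1, ?_,
    Agree.refl _ _ _ _⟩
  rw [Real.sq_sqrt hE.le, Real.sq_sqrt hO.le, mul_comm]

lemma mul_eq_or_eq_neg_of_balanced {K : Type*} [Field K] {E O t s t' s' : K} (hO : O ≠ 0)
    (h : t ^ 2 * E = s ^ 2 * O) (h' : t' ^ 2 * E = s' ^ 2 * O) :
    t * s' = t' * s ∨ t * s' = -(t' * s) := by
  rw [← sq_eq_sq_iff_eq_or_eq_neg]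
  refine mul_right_cancel₀ hO ?_
  linear_combination t' ^ 2 * h - t ^ 2 * h'

lemma ne_zero_of_balanced {K : Type*} [Field K] {E O t s : K} (hO : O ≠ 0)
    (hne : ¬ (t = 0 ∧ s = 0)) (h : t ^ 2 * E = s ^ 2 * O) : t ≠ 0 := by
  rintro rfl
  refine hne ⟨rfl, ?_⟩
  simpa [hO] using h.symm

/-- Uniqueness up to real multiples and the reflection. -/
lemma isContraPhasal_iff_scale {b c k : ℝ} (hb : 0 < b) (hc : 0 < c) (hk : k ≠ 0)
    (hbc : Irrational (b / c)) {f g : GraphFun} (hf : IsContraPhasal b c k f) :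
    IsContraPhasal b c k g ↔ ∃ r : ℝ, r ≠ 0 ∧
      (Agree b c (Ici 0) g (f.scale r) ∨ Agree b c (Ici 0) g ((f.reflect b c).scale r)) := by
  obtain ⟨t, s, hne, hbal, hts⟩ := (isContraPhasal_iff hb hc hk hbc).1 hf
  have hO := (oddSq_pos hk hbc).ne'
  have ht := ne_zero_of_balanced hO hne hbal
  have h1 : ∀ r : ℝ, Agree b c (Ici 0) (f.scale r)
      (standing b c k ((r * t : ℝ) : ℂ) ((r * s : ℝ) : ℂ)) := fun r => by
    have h := hts.scale r
    rw [scale_standing] at h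
    exact_mod_cast h
  have h2 : ∀ r : ℝ, Agree b c (Ici 0) ((f.reflect b c).scale r)
      (standing b c k ((r * t : ℝ) : ℂ) ((r * -s : ℝ) : ℂ)) := fun r => by
    have h := hts.reflect.scale r
    rw [reflect_standing, scale_standing] at h
    exact_mod_cast h
  rw [isContraPhasal_iff hb hc hk hbc]
  constructor
  · rintro ⟨t', s', hne', hbal', hts'⟩
    have ht' := ne_zero_of_balanced hO hne' hbal'
    have htt : t' = t' / t * t := by field_simp
    refine ⟨t' / t, div_ne_zero ht' ht, ?_⟩
    rcases mul_eq_or_eq_neg_of_balanced hO hbal hbal' with h | h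
    · have hss : s' = t' / t * s := by field_simp; linarith
      left
      refine hts'.trans (Agree.symm ?_)
      have := h1 (t' / t)
      rwa [← htt, ← hss] at this
    · have hss : s' = t' / t * -s := by field_simp; linarith
      right
      refine hts'.trans (Agree.symm ?_)
      have := h2 (t' / t)
      rwa [← htt, ← hss] at this
  · rintro ⟨r, hr, h | h⟩
    · exact ⟨r * t, r * s, fun h0 => (mul_ne_zero hr ht) h0.1,
        by linear_combination r ^ 2 * hbal, h.trans (h1 r)⟩
    · exact ⟨r * t, r * -s, fun h0 => (mul_ne_zero hr ht) h0.1,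
        by linear_combination r ^ 2 * hbal, h.trans (h2 r)⟩

lemma isContinuousFamily_standing (b c : ℝ) :
    IsContinuousFamily b c
      (fun k => standing b c k (√(oddSq b c k) : ℝ) (√(evenSq b c k) : ℝ)) := by
  refine ⟨fun i => Continuous.continuousOn ?_, fun j => Continuous.continuousOn ?_⟩
  · simp only [standing, edgeWave, oddSq, evenSq]
    fun_prop
  · fin_cases j <;>
      simp only [Fin.zero_eta, Fin.mk_one, standing_lead_zero, standing_lead_one, wave, leadCos,
        leadSin, oddSq, evenSq] <;>
      fun_prop

/-! ### Eigenfunctions of the compact graph -/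

lemma SolvesOn.eq_affine {s : Set ℝ} (hconv : Convex ℝ s) (h0 : (0 : ℝ) ∈ s) {u : ℝ → ℂ}
    (hu : SolvesOn 0 s u) : ∀ x ∈ s, derivWithin u s x = derivWithin u s 0 ∧
      u x = u 0 + x * derivWithin u s 0 := by
  have hd : ∀ x ∈ s, derivWithin u s x = derivWithin u s 0 := fun x hx =>
    eq_of_hasDerivWithinAt_zero hconv (fun y hy => by simpa using hu.2 y hy) hx h0
  refine fun x hx => ⟨hd x hx, ?_⟩
  have h := eq_of_hasDerivWithinAt_zero hconv
    (u := fun y : ℝ => u y - (y : ℂ) * derivWithin u s 0) (fun y hy => by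
      have h1 := (hu.1 y hy).hasDerivWithinAt.sub
        ((hasDerivAt_id y).ofReal_comp.hasDerivWithinAt.mul_const (derivWithin u s 0))
      refine h1.congr_deriv ?_
      simp [hd y hy]) hx h0
  simp only [Complex.ofReal_zero, zero_mul, sub_zero] at h
  linear_combination h

/-- Zero is not an eigenvalue: a harmonic function is affine on each edge, constant on the lead with
the Neumann condition, hence constant on the cycle and on the other lead. -/
lemma zero_notMem_compactSpectrum {a b c : ℝ} (ha : 0 < a) (hb : 0 < b) (hc : 0 < c) :
    (0 : ℝ) ∉ compactSpectrum a b c := by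
  rintro ⟨f, hf⟩
  have h0 : (0 : ℝ) ∈ Icc 0 a := left_mem_Icc.2 ha.le
  have haa : a ∈ Icc 0 a := right_mem_Icc.2 ha.le
  have hl : ∀ i, (0 : ℝ) ∈ Icc 0 (edgeLength b c i) := fun i =>
    left_mem_Icc.2 (edgeLength_pos hb hc i).le
  have hr : ∀ i, edgeLength b c i ∈ Icc 0 (edgeLength b c i) := fun i =>
    right_mem_Icc.2 (edgeLength_pos hb hc i).le
  have hE := fun i => (hf.solves.edge_eq i).eq_affine (convex_Icc _ _) (hl i)
  have hL := fun j => (hf.solves.lead_eq j).eq_affine (convex_Icc _ _) h0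
  have hn : derivWithin (f.lead 1) (Icc 0 a) 0 = 0 := by
    rw [← (hL 1 a haa).1, hf.neumann]
  have hslope : ∀ i, f.lead 1 0 - f.lead 0 0 =
      edgeLength b c i * derivWithin (f.edge i) (Icc 0 (edgeLength b c i)) 0 := fun i => by
    have h := (hE i _ (hr i)).2
    rw [hf.solves.cont_zero, hf.solves.cont_one] at h
    linear_combination h
  have hsum := hf.solves.deriv_one
  rw [Finset.sum_congr rfl fun i _ => congrArg Neg.neg (hE i _ (hr i)).1, hn,
    Fin.sum_univ_two] at hsum
  have hpos : ((edgeLength b c 0 : ℂ) + edgeLength b c 1) ≠ 0 := by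
    exact_mod_cast (add_pos (edgeLength_pos hb hc 0) (edgeLength_pos hb hc 1)).ne'
  have hlne : ∀ i, (edgeLength b c i : ℂ) ≠ 0 := fun i => by
    exact_mod_cast (edgeLength_pos hb hc i).ne'
  have hs0 : derivWithin (f.edge 0) (Icc 0 (edgeLength b c 0)) 0 = 0 :=
    (mul_eq_zero.1 (show ((edgeLength b c 0 : ℂ) + edgeLength b c 1) * _ = 0 by
      linear_combination hslope 1 - hslope 0 - (edgeLength b c 1 : ℂ) * hsum)).resolve_left hpos
  have hs1 : derivWithin (f.edge 1) (Icc 0 (edgeLength b c 1)) 0 = 0 := by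
    linear_combination -hsum - hs0
  have hslead : derivWithin (f.lead 0) (Icc 0 a) 0 = 0 := by
    have h := hf.solves.deriv_zero
    rw [Fin.sum_univ_two] at h
    linear_combination h - hs0 - hs1
  have hv0 : f.lead 0 0 = 0 := by
    have h := (hL 0 a haa).2
    rw [hf.dirichlet, hslead] at h
    linear_combination -h
  have hv1 : f.lead 1 0 = 0 := by
    have h := hslope 0
    rw [hs0, hv0] at h
    linear_combination h
  refine hf.ne_zero ⟨fun i x hx => ?_, fun j x hx => ?_⟩
  · rw [(hE i x hx).2, hf.solves.cont_zero, hv0]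
    fin_cases i <;> simp [hs0, hs1, GraphFun.zero]
  · rw [(hL j x hx).2]
    fin_cases j <;> simp [hv0, hv1, hn, hslead, GraphFun.zero]

/-- A function that agrees with a member of the family `standing` is an eigenfunction of the compact
graph exactly if its parameters, not both zero, solve the two linear equations given by the
conditions at the ends of the leads. -/
lemma isEigenfunction_iff_of_agree {a b c k : ℝ} (ha : 0 < a) (hb : 0 < b) (hc : 0 < c)
    (hk : k ≠ 0) (hbc : Irrational (b / c)) {f : GraphFun} {t s : ℂ}
    (hf : Agree b c (Icc 0 a) f (standing b c k t s)) :
    IsEigenfunction a b c (k ^ 2) f ↔ ¬ (t = 0 ∧ s = 0) ∧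
      wave k (leadCos b c k t s) (leadSin b c k t s) a = 0 ∧
      wave k (leadSin b c k t (-s)) (-leadCos b c k t (-s)) a = 0 := by
  have hkC : (k : ℂ) ≠ 0 := by exact_mod_cast hk
  have h0 : (0 : ℝ) ∈ Icc 0 a := left_mem_Icc.2 ha.le
  have haa : a ∈ Icc 0 a := right_mem_Icc.2 ha.le
  have hS := uniqueDiffOn_Icc ha
  have hD : f.lead 0 a = wave k (leadCos b c k t s) (leadSin b c k t s) a := hf.2 0 haa
  have hN : derivWithin (f.lead 1) (Icc 0 a) a =
      k * wave k (leadSin b c k t (-s)) (-leadCos b c k t (-s)) a := by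
    rw [derivWithin_congr (hf.2 1) (hf.2 1 haa), standing_lead_one, derivWithin_wave (hS a haa)]
  constructor
  · intro h
    refine ⟨?_, hD ▸ h.dirichlet, (mul_eq_zero.1 (hN ▸ h.neumann)).resolve_left hkC⟩
    rintro ⟨rfl, rfl⟩
    apply h.ne_zero
    rwa [standing_zero] at hf
  · rintro ⟨hne, h1, h2⟩
    refine ⟨(solvesGraph_standing hb hc k hS h0 t s).congr hb hc h0 hf, hD.trans h1,
      by rw [hN, h2, mul_zero], fun h => hne ?_⟩
    exact eq_zero_of_leads_eq_zero hk hbc hS h0 (hf.symm.trans h).2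

/-- The two conditions at the ends of the leads force the amplitudes of the even and the odd part to
agree up to sign: they read `t • S·e = -s • T·e` and `t • S·e' = s • T·e'` for an orthonormal basis
`e`, `e'`. -/
lemma balanced_of_end_conditions {a b c k : ℝ} {t s : ℂ}
    (h1 : wave k (leadCos b c k t s) (leadSin b c k t s) a = 0)
    (h2 : wave k (leadSin b c k t (-s)) (-leadCos b c k t (-s)) a = 0) :
    t ^ 2 * (evenSq b c k : ℂ) = s ^ 2 * (oddSq b c k : ℂ) := by
  have h3 : (Real.sin (k * a) : ℂ) ^ 2 + (Real.cos (k * a) : ℂ) ^ 2 = 1 := by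
    exact_mod_cast Real.sin_sq_add_cos_sq (k * a)
  simp only [wave, leadCos, leadSin] at h1 h2
  simp only [evenSq, oddSq, Complex.ofReal_add, Complex.ofReal_pow]
  generalize ((Real.cos (k * b) * Real.cos (k * c) : ℝ) : ℂ) = α at *
  generalize ((Real.sin (k * b) * Real.sin (k * c) : ℝ) : ℂ) = β at *
  generalize (Real.sin (k * b + k * c) : ℂ) = σ at *
  generalize (Real.cos (k * a) : ℂ) = x at *
  generalize (Real.sin (k * a) : ℂ) = y at *
  linear_combination (t * (α * x - σ * y) - s * (β * x + σ * y)) * h1 +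
    (t * (-σ * x - α * y) + s * (σ * x - β * y)) * h2 -
    (t ^ 2 * (α ^ 2 + σ ^ 2) - s ^ 2 * (β ^ 2 + σ ^ 2)) * h3

/-- The solution space of the two conditions at the ends of the leads is at most
one-dimensional. -/
lemma mul_eq_mul_of_end_conditions {a b c k : ℝ} (hk : k ≠ 0) (hbc : Irrational (b / c))
    {t s t' s' : ℂ}
    (h1 : wave k (leadCos b c k t s) (leadSin b c k t s) a = 0)
    (h2 : wave k (leadSin b c k t (-s)) (-leadCos b c k t (-s)) a = 0)
    (h1' : wave k (leadCos b c k t' s') (leadSin b c k t' s') a = 0)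
    (h2' : wave k (leadSin b c k t' (-s')) (-leadCos b c k t' (-s')) a = 0) :
    t * s' = t' * s := by
  have hE : (evenSq b c k : ℂ) ≠ 0 := by exact_mod_cast (evenSq_pos hk hbc).ne'
  have h3 : (Real.sin (k * a) : ℂ) ^ 2 + (Real.cos (k * a) : ℂ) ^ 2 = 1 := by
    exact_mod_cast Real.sin_sq_add_cos_sq (k * a)
  rw [← sub_eq_zero]
  refine (mul_eq_zero.1 ?_).resolve_right hE
  simp only [wave, leadCos, leadSin] at h1 h2 h1' h2'
  simp only [evenSq, Complex.ofReal_add, Complex.ofReal_pow]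
  generalize ((Real.cos (k * b) * Real.cos (k * c) : ℝ) : ℂ) = α at *
  generalize (Real.sin (k * b + k * c) : ℂ) = σ at *
  generalize (Real.cos (k * a) : ℂ) = x at *
  generalize (Real.sin (k * a) : ℂ) = y at *
  linear_combination (α * x - σ * y) * (s' * h1 - s * h1') +
    (-σ * x - α * y) * (s' * h2 - s * h2') - (t * s' - t' * s) * (α ^ 2 + σ ^ 2) * h3

/-- The eigenfunctions at a given eigenvalue are the nonzero multiples of any one of them. -/
lemma IsEigenfunction.exists_agree_scale {a b c k : ℝ} (ha : 0 < a) (hb : 0 < b) (hc : 0 < c)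
    (hk : k ≠ 0) (hbc : Irrational (b / c)) {g h : GraphFun}
    (hg : IsEigenfunction a b c (k ^ 2) g) (hh : IsEigenfunction a b c (k ^ 2) h) :
    ∃ z : ℂ, z ≠ 0 ∧ Agree b c (Icc 0 a) g (h.scale z) := by
  have h0 : (0 : ℝ) ∈ Icc 0 a := left_mem_Icc.2 ha.le
  have hO : (oddSq b c k : ℂ) ≠ 0 := by exact_mod_cast (oddSq_pos hk hbc).ne'
  obtain ⟨t, s, hts⟩ := hh.solves.exists_standing hb hc hk hbc (convex_Icc 0 a)
    (uniqueDiffOn_Icc ha) h0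
  obtain ⟨t', s', hts'⟩ := hg.solves.exists_standing hb hc hk hbc (convex_Icc 0 a)
    (uniqueDiffOn_Icc ha) h0
  obtain ⟨hne, h1, h2⟩ := (isEigenfunction_iff_of_agree ha hb hc hk hbc hts).1 hh
  obtain ⟨hne', h1', h2'⟩ := (isEigenfunction_iff_of_agree ha hb hc hk hbc hts').1 hg
  have ht := ne_zero_of_balanced hO hne (balanced_of_end_conditions h1 h2)
  have ht' := ne_zero_of_balanced hO hne' (balanced_of_end_conditions h1' h2')
  have hcross := mul_eq_mul_of_end_conditions hk hbc h1 h2 h1' h2'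
  refine ⟨t' / t, div_ne_zero ht' ht, hts'.trans (Agree.symm ?_)⟩
  have h := hts.scale (t' / t)
  rwa [scale_standing, show t' / t * t = t' by field_simp,
    show t' / t * s = s' by field_simp; linear_combination -hcross] at h

lemma IsContraPhasal.isEigenfunction_or_reflect {a b c k : ℝ} (ha : 0 < a) (hb : 0 < b)
    (hc : 0 < c) (hk : k ≠ 0) (hbc : Irrational (b / c))
    (hspec : k ^ 2 ∈ compactSpectrum a b c) {f : GraphFun} (hf : IsContraPhasal b c k f) :
    ∃ h, (h = f ∨ h = f.reflect b c) ∧ IsEigenfunction a b c (k ^ 2) h := by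
  obtain ⟨g, hg⟩ := hspec
  have hO : (oddSq b c k : ℂ) ≠ 0 := by exact_mod_cast (oddSq_pos hk hbc).ne'
  obtain ⟨t, s, hne, hbal, hts⟩ := (isContraPhasal_iff hb hc hk hbc).1 hf
  obtain ⟨t', s', hts'⟩ := hg.solves.exists_standing hb hc hk hbc (convex_Icc 0 a)
    (uniqueDiffOn_Icc ha) (left_mem_Icc.2 ha.le)
  obtain ⟨hne', h1, h2⟩ := (isEigenfunction_iff_of_agree ha hb hc hk hbc hts').1 hg
  have hbal' := balanced_of_end_conditions h1 h2
  have ht' := ne_zero_of_balanced hO hne' hbal'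
  have htC : (t : ℂ) ≠ 0 := by
    exact_mod_cast ne_zero_of_balanced (oddSq_pos hk hbc).ne' hne hbal
  have hbalC : (t : ℂ) ^ 2 * (evenSq b c k : ℂ) = (s : ℂ) ^ 2 * (oddSq b c k : ℂ) := by
    exact_mod_cast hbal
  have hts0 := hts.mono (T := Icc 0 a) Icc_subset_Ici_self
  -- A function whose parameters `t`, `s''` are proportional to those of `g` is an eigenfunction.
  have key : ∀ (h : GraphFun) (s'' : ℂ), Agree b c (Icc 0 a) h (standing b c k t s'') →
      t * s' = t' * s'' → IsEigenfunction a b c (k ^ 2) h := by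
    intro h s'' hag hcross
    refine (isEigenfunction_iff_of_agree ha hb hc hk hbc hag).2 ⟨fun h0 => htC h0.1, ?_, ?_⟩
    · refine (mul_eq_zero.1 ?_).resolve_left ht'
      simp only [wave, leadCos, leadSin] at h1 ⊢
      generalize ((Real.cos (k * b) * Real.cos (k * c) : ℝ) : ℂ) = α at *
      generalize ((Real.sin (k * b) * Real.sin (k * c) : ℝ) : ℂ) = β at *
      linear_combination t * h1 - (β * (Real.cos (k * a) : ℂ) +
        (Real.sin (k * b + k * c) : ℂ) * (Real.sin (k * a) : ℂ)) * hcross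
    · refine (mul_eq_zero.1 ?_).resolve_left ht'
      simp only [wave, leadCos, leadSin] at h2 ⊢
      generalize ((Real.cos (k * b) * Real.cos (k * c) : ℝ) : ℂ) = α at *
      generalize ((Real.sin (k * b) * Real.sin (k * c) : ℝ) : ℂ) = β at *
      linear_combination t * h2 + ((Real.sin (k * b + k * c) : ℂ) * (Real.cos (k * a) : ℂ) -
        β * (Real.sin (k * a) : ℂ)) * hcross
  rcases mul_eq_or_eq_neg_of_balanced hO hbalC hbal' with h | h
  · exact ⟨f, Or.inl rfl, key f s hts0 h⟩
  · have hrefl := hts0.reflect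
    rw [reflect_standing] at hrefl
    exact ⟨f.reflect b c, Or.inr rfl, key _ (-s) hrefl (by rw [h]; ring)⟩

end TwoLeadCycle

theorem mainTheorem8 (a b c : ℝ) (ha : 0 < a) (hb : 0 < b) (hc : 0 < c)
    (hbc : Irrational (b / c)) :
    -- existence, and uniqueness up to real scalars and the reflection
    (∀ k : ℝ, k ≠ 0 →
      (∃ f, TwoLeadCycle.IsContraPhasal b c k f) ∧
      ∀ f g, TwoLeadCycle.IsContraPhasal b c k f →
        (TwoLeadCycle.IsContraPhasal b c k g ↔
          ∃ r : ℝ, r ≠ 0 ∧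
            (TwoLeadCycle.Agree b c (Set.Ici 0) g (f.scale r) ∨
              TwoLeadCycle.Agree b c (Set.Ici 0) g ((f.reflect b c).scale r)))) ∧
    -- continuous choice
    (∃ F : ℝ → TwoLeadCycle.GraphFun,
      (∀ k : ℝ, k ≠ 0 → TwoLeadCycle.IsContraPhasal b c k (F k)) ∧
      TwoLeadCycle.IsContinuousFamily b c F) ∧
    -- at eigenvalues of the compact graph
    (∀ k : ℝ, k ^ 2 ∈ TwoLeadCycle.compactSpectrum a b c →
      ∀ f, TwoLeadCycle.IsContraPhasal b c k f →
        ∃ h, (h = f ∨ h = f.reflect b c) ∧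
          TwoLeadCycle.IsEigenfunction a b c (k ^ 2) h ∧
          ∀ g, TwoLeadCycle.IsEigenfunction a b c (k ^ 2) g →
            ∃ z : ℂ, z ≠ 0 ∧ TwoLeadCycle.Agree b c (Set.Icc 0 a) g (h.scale z)) := by
  refine ⟨fun k hk => ⟨⟨_, TwoLeadCycle.isContraPhasal_standing hb hc hk hbc⟩,
      fun f g hf => TwoLeadCycle.isContraPhasal_iff_scale hb hc hk hbc hf⟩,
    ⟨_, fun k hk => TwoLeadCycle.isContraPhasal_standing hb hc hk hbc,
      TwoLeadCycle.isContinuousFamily_standing b c⟩, fun k hspec f hf => ?_⟩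
  have hk : k ≠ 0 := by
    rintro rfl
    rw [zero_pow two_ne_zero] at hspec
    exact TwoLeadCycle.zero_notMem_compactSpectrum ha hb hc hspec
  obtain ⟨h, hh, heig⟩ := hf.isEigenfunction_or_reflect ha hb hc hk hbc hspec
  exact ⟨h, hh, heig, fun g hg => hg.exists_agree_scale ha hb hc hk hbc heig⟩
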